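/- For a finite set $S$ of integers let $S+S=\{a+b: a,b\in S\}$ and $S-S=\{a-b: a,b\in S\}$. For $S\subseteq\{0,1,\dots,n\}$ let $\lambda_n(S)=\bigl(2n+1-|S+S|,\;2n+1-|S-S|\bigr)$ be the pair (number of missing sums, number of missing differences). For $\Lambda\subseteq\mathbb{Z}_{\ge0}\times\mathbb{Z}_{\ge0}$ let $\rho_n^\Lambda=2^{-n-1}\,\bigl|\{S\subseteq\{0,\dots,n\}:\lambda_n(S)\in\Lambda\}\bigr|$. For integers $a,b$ let $[a,b]$ denote the set of integers $k$ with $a\le k\le b$. **Theorem.** Let $\Lambda\subseteq\mathbb{Z}_{\ge0}\times\mathbb{Z}_{\ge0}$ contain at least one element $(s,d)$ with $d$ even. Then the limit $\rho^\Lambda=\lim_{n\to\infty}\rho_n^\Lambda$ exists and is positive, and the following holds. Let $(\alpha_n)$ be a sequence of integers with $0<\alpha_n<n/2$ for all sufficiently large $n$ and $\alpha_n\to\infty$ as $n\to\infty$, and let $\epsilon>0$. Then for all sufficiently large $n$ (depending on $\Lambda$, the sequence $(\alpha_n)$ and $\epsilon$ only): if $S$ is a uniform random subset of $\{0,1,\dots,n\}$,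 $E$ is any event that depends only on $S\cap[\alpha_n+1,\,n-\alpha_n-1]$, and $F$ is any event that depends only on $S\cap\bigl([0,\alpha_n]\cup[n-\alpha_n,\,n]\bigr)$, then $$\Bigl|\,\mathbb{P}\bigl(E\cap F\mid\lambda_n(S)\in\Lambda\bigr)-\mathbb{P}(E)\,\mathbb{P}\bigl(F\mid\lambda_n(S)\in\Lambda\bigr)\Bigr|\;\le\;(1+\epsilon)\,\frac{24\,(3/4)^{\alpha_n/2}}{(2-\sqrt3)\,\rho^\Lambda}.$$ -/

import Mathlib

open Filter Topology MeasureTheory ProbabilityTheory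
open scoped Pointwise

namespace MiddleFringe

/-- Every set of finite sets of integers is an event. -/
instance instMeasurableSpaceFinsetInt : MeasurableSpace (Finset ℤ) := ⊤

/-- The set `{0, 1, …, n}`. -/
noncomputable def ground (n : ℕ) : Finset ℤ := Finset.Icc 0 (n : ℤ)

/-- The law of a uniform random subset of `{0, 1, …, n}`. -/
noncomputable def unif (n : ℕ) : Measure (Finset ℤ) :=
  uniformOn ((ground n).powerset : Set (Finset ℤ))

/-- `λₙ(S) = (2n + 1 - |S + S|, 2n + 1 - |S - S|)`: the number of missing sums and the number of
missing differences. For `S ⊆ {0, …, n}` the subtractions do not truncate, see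
`card_add_le` and `card_sub_le`. -/
def missing (n : ℕ) (S : Finset ℤ) : ℕ × ℕ :=
  (2 * n + 1 - (S + S).card, 2 * n + 1 - (S - S).card)

theorem card_add_le {n : ℕ} {S : Finset ℤ} (hS : S ⊆ ground n) : (S + S).card ≤ 2 * n + 1 := by
  have h : S + S ⊆ Finset.Icc (0 : ℤ) (2 * n) := by
    intro x hx
    obtain ⟨a, ha, b, hb, rfl⟩ := Finset.mem_add.1 hx
    have h1 := Finset.mem_Icc.1 (hS ha)
    have h2 := Finset.mem_Icc.1 (hS hb)
    exact Finset.mem_Icc.2 ⟨by omega, by omega⟩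
  refine (Finset.card_le_card h).trans ?_
  rw [Int.card_Icc]
  omega

theorem card_sub_le {n : ℕ} {S : Finset ℤ} (hS : S ⊆ ground n) : (S - S).card ≤ 2 * n + 1 := by
  have h : S - S ⊆ Finset.Icc (-n : ℤ) n := by
    intro x hx
    obtain ⟨a, ha, b, hb, rfl⟩ := Finset.mem_sub.1 hx
    have h1 := Finset.mem_Icc.1 (hS ha)
    have h2 := Finset.mem_Icc.1 (hS hb)
    exact Finset.mem_Icc.2 ⟨by omega, by omega⟩
  refine (Finset.card_le_card h).trans ?_
  rw [Int.card_Icc]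
  omega

/-- The event `λₙ(S) ∈ Λ`. -/
def charEvent (Λ : Set (ℕ × ℕ)) (n : ℕ) : Set (Finset ℤ) := {S | missing n S ∈ Λ}

/-- `ρₙ^Λ`: the proportion of the subsets `S` of `{0, …, n}` with `λₙ(S) ∈ Λ`. -/
noncomputable def rho (Λ : Set (ℕ × ℕ)) (n : ℕ) : ℝ :=
  ({S : Finset ℤ | S ⊆ ground n ∧ missing n S ∈ Λ}.ncard : ℝ) / 2 ^ (n + 1)

/-- The event `E` about subsets `S` of `{0, …, n}` depends only on `S ∩ W`. -/
def DependsOnlyOn (n : ℕ) (W : Finset ℤ) (E : Set (Finset ℤ)) : Prop :=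
  ∀ S T : Finset ℤ, S ⊆ ground n → T ⊆ ground n → S ∩ W = T ∩ W → (S ∈ E ↔ T ∈ E)

end MiddleFringe

/-! A sum or difference far from the extremes has many representations, so it is rarely missing.
Representations of one value by disjoint pairs are independent, and each fails with probability
`3/4`. Hence a value at distance `i` from its extreme is missing with probability about `(√3/2)^i`,
and a geometric series bounds the probability that `S` is not `Rich`
(`eventually_unif_real_not_rich_le`).

On rich sets `missing` is a function of the two fringes alone (`missing_eq_fringeMissing`). So
`charEvent` differs from `fringeEvent` only on non-rich sets, and `fringeEvent` is exactly
independent of the middle. Replacing one event by the other twice gives the error bound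
(`abs_cond_inter_sub_le`).

The same comparison gives the limit, because the probability of a fringe event does not depend on
`n`. The limit is positive because explicit fringes realise `(s, 2e)` (`exists_fringes`), and gluing
them around rich sets yields a positive proportion of all subsets (`countSubsets_rich_le`). -/

namespace MiddleFringe

/-! ### Counting subsets and independence over disjoint sets of points -/

open scoped Classical in
/-- The number of subsets of `G` with the property `p`. -/
noncomputable def countSubsets (G : Finset ℤ) (p : Finset ℤ → Prop) : ℕ :=
  (G.powerset.filter p).card

theorem countSubsets_congr {G : Finset ℤ} {p q : Finset ℤ → Prop} (h : ∀ S ⊆ G, (p S ↔ q S)) :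
    countSubsets G p = countSubsets G q := by
  classical
  exact congrArg Finset.card (Finset.filter_congr fun S hS => h S (Finset.mem_powerset.1 hS))

theorem countSubsets_mono {G : Finset ℤ} {p q : Finset ℤ → Prop} (h : ∀ S ⊆ G, p S → q S) :
    countSubsets G p ≤ countSubsets G q := by
  classical
  refine Finset.card_le_card fun S hS => ?_
  rw [Finset.mem_filter] at hS ⊢
  exact ⟨hS.1, h S (Finset.mem_powerset.1 hS.1) hS.2⟩

theorem countSubsets_true (G : Finset ℤ) : countSubsets G (fun _ => True) = 2 ^ G.card := by
  classical
  simp [countSubsets, Finset.card_powerset]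

/-- Counting subsets of a disjoint union by their traces on the two parts. -/
theorem countSubsets_union {W V : Finset ℤ} (h : Disjoint W V) (p q : Finset ℤ → Prop) :
    countSubsets (W ∪ V) (fun S => p (S ∩ W) ∧ q (S ∩ V)) =
      countSubsets W p * countSubsets V q := by
  classical
  rw [countSubsets, countSubsets, countSubsets, ← Finset.card_product]
  have key : ∀ X Y : Finset ℤ, X ⊆ W → Y ⊆ V → (X ∪ Y) ∩ W = X ∧ (X ∪ Y) ∩ V = Y := by
    intro X Y hX hY
    rw [Finset.disjoint_left] at h
    constructor
    · ext x; simp only [Finset.mem_inter, Finset.mem_union]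
      exact ⟨fun hx => hx.1.elim id fun hy => absurd (hY hy) (h hx.2), fun hx => ⟨.inl hx, hX hx⟩⟩
    · ext x; simp only [Finset.mem_inter, Finset.mem_union]
      exact ⟨fun hx => hx.1.elim (fun hy => absurd hx.2 (h (hX hy))) id, fun hx => ⟨.inr hx, hY hx⟩⟩
  refine Finset.card_bij' (fun S _ => (S ∩ W, S ∩ V)) (fun P _ => P.1 ∪ P.2) ?_ ?_ ?_ ?_
  · intro S hS
    simp only [Finset.mem_filter, Finset.mem_powerset, Finset.mem_product] at hS ⊢
    exact ⟨⟨Finset.inter_subset_right, hS.2.1⟩, Finset.inter_subset_right, hS.2.2⟩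
  · intro P hP
    simp only [Finset.mem_filter, Finset.mem_powerset, Finset.mem_product] at hP ⊢
    obtain ⟨h1, h2⟩ := key P.1 P.2 hP.1.1 hP.2.1
    rw [h1, h2]
    exact ⟨Finset.union_subset_union hP.1.1 hP.2.1, hP.1.2, hP.2.2⟩
  · intro S hS
    simp only [Finset.mem_filter, Finset.mem_powerset] at hS
    change S ∩ W ∪ S ∩ V = S
    rw [← Finset.inter_union_distrib_left, Finset.inter_eq_left]
    exact hS.1
  · intro P hP
    simp only [Finset.mem_filter, Finset.mem_powerset, Finset.mem_product] at hP
    obtain ⟨h1, h2⟩ := key P.1 P.2 hP.1.1 hP.2.1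
    exact Prod.ext h1 h2

/-- A subset of `G` avoids each of `t` disjoint pairs with probability at most `(3/4)^t`. -/
theorem card_avoid_pairs_le (v : ℤ → ℤ) (T G : Finset ℤ) (hTG : T ⊆ G)
    (hv : ∀ j ∈ T, v j ∈ G \ T) (hinj : Set.InjOn v T) :
    countSubsets G (fun S => ∀ j ∈ T, ¬ (j ∈ S ∧ v j ∈ S)) * 4 ^ T.card ≤
      3 ^ T.card * 2 ^ G.card := by
  induction T using Finset.induction_on generalizing G with
  | empty => simp [countSubsets_true]
  | insert j T hj ih =>
    have hjG : j ∈ G := hTG (Finset.mem_insert_self _ _)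
    have hvj := hv j (Finset.mem_insert_self _ _)
    rw [Finset.mem_sdiff, Finset.mem_insert, not_or] at hvj
    obtain ⟨hvG, hne, hvT⟩ := hvj
    set W : Finset ℤ := {j, v j} with hW
    have hWcard : W.card = 2 := Finset.card_pair (Ne.symm hne)
    have hWG : W ⊆ G := by
      intro x hx
      rw [hW, Finset.mem_insert, Finset.mem_singleton] at hx
      rcases hx with rfl | rfl <;> assumption
    set V : Finset ℤ := G \ W with hV
    have hdis : Disjoint W V := Finset.disjoint_sdiff
    have hWV : W ∪ V = G := Finset.union_sdiff_of_subset hWG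
    have hT : ∀ i ∈ T, i ∈ V ∧ v i ∈ V := by
      intro i hi
      have hi' : i ∈ insert j T := Finset.mem_insert_of_mem hi
      have h1 := Finset.mem_sdiff.1 (hv i hi')
      rw [Finset.mem_insert, not_or] at h1
      rw [hV, Finset.mem_sdiff, Finset.mem_sdiff, hW]
      simp only [Finset.mem_insert, Finset.mem_singleton, not_or]
      refine ⟨⟨hTG hi', ?_, ?_⟩, h1.1, h1.2.1, ?_⟩
      · rintro rfl; exact hj hi
      · rintro rfl; exact hvT hi
      · intro he
        have := hinj (Finset.mem_coe.2 hi') (Finset.mem_coe.2 (Finset.mem_insert_self _ _)) he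
        subst this; exact hj hi
    have ih' := ih V (fun i hi => (hT i hi).1)
      (fun i hi => Finset.mem_sdiff.2 ⟨(hT i hi).2, fun h =>
        (Finset.mem_sdiff.1 (hv i (Finset.mem_insert_of_mem hi))).2 (Finset.mem_insert_of_mem h)⟩)
      (hinj.mono (by simp))
    -- The pair `W` is split off: its trace is one of three proper subsets out of four, and the
    -- remaining conditions live on `V`.
    have hle : countSubsets G (fun S => ∀ i ∈ insert j T, ¬ (i ∈ S ∧ v i ∈ S)) ≤
        countSubsets (W ∪ V)
          (fun S => (S ∩ W ≠ W) ∧ (∀ i ∈ T, ¬ (i ∈ S ∩ V ∧ v i ∈ S ∩ V))) := by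
      rw [hWV]
      refine countSubsets_mono fun S _ hS => ⟨?_, ?_⟩
      · intro he
        have := Finset.inter_eq_right.1 he
        exact hS j (Finset.mem_insert_self _ _) ⟨this (by simp [hW]), this (by simp [hW])⟩
      · intro i hi h
        exact hS i (Finset.mem_insert_of_mem hi)
          ⟨(Finset.mem_inter.1 h.1).1, (Finset.mem_inter.1 h.2).1⟩
    have h3 : countSubsets W (fun S => S ≠ W) = 3 := by
      classical
      have he : W.powerset.filter (fun S => S ≠ W) = W.powerset.erase W := by
        ext S; rw [Finset.mem_filter, Finset.mem_erase, and_comm]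
      rw [countSubsets, ← Finset.filter_congr_decidable, he, Finset.card_erase_of_mem (Finset.mem_powerset_self _),
        Finset.card_powerset, hWcard]
      norm_num
    rw [countSubsets_union hdis (fun S => S ≠ W)
      (fun S => ∀ i ∈ T, ¬ (i ∈ S ∧ v i ∈ S)), h3] at hle
    have hG : G.card = V.card + 2 := by
      rw [← hWV, Finset.card_union_of_disjoint hdis, hWcard, add_comm]
    rw [Finset.card_insert_of_notMem hj, hG, pow_succ, pow_succ, pow_add]
    calc _ ≤ 3 * countSubsets V (fun S => ∀ i ∈ T, ¬ (i ∈ S ∧ v i ∈ S)) *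
          (4 ^ T.card * 4) := Nat.mul_le_mul_right _ hle
      _ = 12 * (countSubsets V (fun S => ∀ i ∈ T, ¬ (i ∈ S ∧ v i ∈ S)) * 4 ^ T.card) := by
          ring
      _ ≤ 12 * (3 ^ T.card * 2 ^ V.card) := Nat.mul_le_mul_left _ ih'
      _ = _ := by ring

theorem card_ground (n : ℕ) : (ground n).card = n + 1 := by
  simp [ground]

theorem unif_real (n : ℕ) (E : Set (Finset ℤ)) :
    (unif n).real E = countSubsets (ground n) (· ∈ E) / 2 ^ (n + 1) := by
  classical
  have hE : ∀ A : Set (Finset ℤ), MeasurableSet A := fun _ => trivial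
  have : MeasurableSingletonClass (Finset ℤ) := ⟨fun _ => trivial⟩
  have h1 : ((ground n).powerset : Set (Finset ℤ)) ∩ E =
      (((ground n).powerset.filter (· ∈ E) : Finset (Finset ℤ)) : Set (Finset ℤ)) := by
    ext S; simp
  rw [unif, uniformOn, measureReal_def, cond_apply (hE _), h1,
    Measure.count_apply_finset, Measure.count_apply_finset, Finset.card_powerset, card_ground]
  simp [div_eq_inv_mul, countSubsets]

instance (n : ℕ) : IsProbabilityMeasure (unif n) := by
  have : MeasurableSingletonClass (Finset ℤ) := ⟨fun _ => trivial⟩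
  exact isProbabilityMeasure_uniformOn (Finset.finite_toSet _) ⟨∅, by simp⟩

/-- Events that depend on disjoint sets of points are independent. -/
theorem unif_real_inter {n : ℕ} {W V : Finset ℤ} (h : Disjoint W V) (hWV : W ∪ V = ground n)
    {E F : Set (Finset ℤ)} (hE : DependsOnlyOn n W E) (hF : DependsOnlyOn n V F) :
    (unif n).real (E ∩ F) = (unif n).real E * (unif n).real F := by
  have e1 : ∀ S ⊆ ground n, (S ∈ E ↔ S ∩ W ∈ E) := fun S hS =>
    hE S (S ∩ W) hS (Finset.inter_subset_left.trans hS) (by simp)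
  have e2 : ∀ S ⊆ ground n, (S ∈ F ↔ S ∩ V ∈ F) := fun S hS =>
    hF S (S ∩ V) hS (Finset.inter_subset_left.trans hS) (by simp)
  have c1 := countSubsets_union h (· ∈ E) (· ∈ F)
  have c2 := countSubsets_union h (· ∈ E) (fun _ => True)
  have c3 := countSubsets_union h (fun _ => True) (· ∈ F)
  simp only [countSubsets_true, true_and, and_true] at c2 c3
  rw [hWV] at c1 c2 c3
  have hc : (2 : ℝ) ^ (n + 1) = 2 ^ W.card * 2 ^ V.card := by
    rw [← pow_add, ← Finset.card_union_of_disjoint h, hWV, card_ground]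
  have d1 : countSubsets (ground n) (· ∈ E ∩ F) =
      countSubsets (ground n) (fun S => S ∩ W ∈ E ∧ S ∩ V ∈ F) :=
    countSubsets_congr fun S hS => by rw [Set.mem_inter_iff, e1 S hS, e2 S hS]
  rw [unif_real, unif_real, unif_real, hc, d1, c1, countSubsets_congr e1, c2,
    countSubsets_congr e2, c3]
  push_cast
  field_simp

theorem unif_real_avoid_pairs_le (n : ℕ) (v : ℤ → ℤ) (T : Finset ℤ) (hT : T ⊆ ground n)
    (hv : ∀ j ∈ T, v j ∈ ground n \ T) (hinj : Set.InjOn v T) :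
    (unif n).real {S | ∀ j ∈ T, ¬ (j ∈ S ∧ v j ∈ S)} ≤ (3 / 4 : ℝ) ^ T.card := by
  have h := card_avoid_pairs_le v T (ground n) hT hv hinj
  rw [card_ground] at h
  rw [unif_real, div_pow, div_le_div_iff₀ (by positivity) (by positivity)]
  exact_mod_cast h

theorem unif_real_mono {n : ℕ} {E F : Set (Finset ℤ)} (h : ∀ S ⊆ ground n, S ∈ E → S ∈ F) :
    (unif n).real E ≤ (unif n).real F := by
  rw [unif_real, unif_real]
  gcongr
  exact countSubsets_mono h

theorem rho_eq_unif_real (Λ : Set (ℕ × ℕ)) (n : ℕ) :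
    rho Λ n = (unif n).real (charEvent Λ n) := by
  classical
  rw [unif_real, rho, countSubsets, ← Set.ncard_coe_finset]
  congr 3
  ext S
  rw [Finset.mem_coe, Finset.mem_filter, Finset.mem_powerset]
  rfl

/-! ### Probability that a given sum or difference is missing -/

theorem sqrt_three_div_two_sq : (√3 / 2) ^ 2 = (3 / 4 : ℝ) := by
  rw [div_pow, Real.sq_sqrt (by norm_num)]; norm_num

theorem sqrt_three_div_two_pos : 0 < √3 / 2 := by positivity

theorem sqrt_three_div_two_lt_one : √3 / 2 < 1 := by
  rw [div_lt_one (by norm_num), Real.sqrt_lt' (by norm_num)]; norm_num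

theorem three_quarters_pow_le {m k : ℕ} (h : k ≤ 2 * m) : (3 / 4 : ℝ) ^ m ≤ (√3 / 2) ^ k := by
  rw [← sqrt_three_div_two_sq, ← pow_mul]
  exact pow_le_pow_of_le_one sqrt_three_div_two_pos.le sqrt_three_div_two_lt_one.le h

theorem mem_ground {n : ℕ} {x : ℤ} : x ∈ ground n ↔ 0 ≤ x ∧ x ≤ n := by
  rw [ground, Finset.mem_Icc]

/-- The pairs are `{j, i - j}` with `j < i - j`. For even `i` the midpoint is left out, which still
leaves at least `i / 2` pairs. -/
theorem unif_real_low_sum_missing_le {n i : ℕ} (hi : i ≤ n) :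
    (unif n).real {S | (i : ℤ) ∉ S + S} ≤ (√3 / 2) ^ i := by
  refine (measureReal_mono ?_).trans ((unif_real_avoid_pairs_le n (fun j => i - j)
    (Finset.Icc 0 (((i : ℤ) - 1) / 2)) ?_ ?_ ?_).trans (three_quarters_pow_le ?_))
  · intro S hS j _ h
    exact hS (Finset.mem_add.2 ⟨j, h.1, _, h.2, by ring⟩)
  · intro j hj
    rw [Finset.mem_Icc] at hj
    rw [mem_ground]; omega
  · intro j hj
    rw [Finset.mem_Icc] at hj
    rw [Finset.mem_sdiff, mem_ground, Finset.mem_Icc]; omega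
  · intro x _ y _ h
    simpa using h
  · rw [Int.card_Icc]; omega

theorem unif_real_high_sum_missing_le {n i : ℕ} (hi : i ≤ n) :
    (unif n).real {S | (2 * n - i : ℤ) ∉ S + S} ≤ (√3 / 2) ^ i := by
  refine (measureReal_mono ?_).trans ((unif_real_avoid_pairs_le n (fun j => (2 * n - i) - j)
    (Finset.Icc ((2 * n - i : ℤ) / 2 + 1) n) ?_ ?_ ?_).trans (three_quarters_pow_le ?_))
  · intro S hS j _ h
    exact hS (Finset.mem_add.2 ⟨j, h.1, _, h.2, by ring⟩)
  · intro j hj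
    rw [Finset.mem_Icc] at hj
    rw [mem_ground]; omega
  · intro j hj
    rw [Finset.mem_Icc] at hj
    rw [Finset.mem_sdiff, mem_ground, Finset.mem_Icc]; omega
  · intro x _ y _ h
    simpa using h
  · rw [Int.card_Icc]; omega

theorem unif_real_difference_missing_le_of_pairs {n : ℕ} {k : ℤ} {T : Finset ℤ}
    (hT : ∀ j ∈ T, 0 ≤ j ∧ j ≤ n ∧ 0 ≤ j + k ∧ j + k ≤ n ∧ j + k ∉ T) :
    (unif n).real {S | k ∉ S - S} ≤ (3 / 4 : ℝ) ^ T.card := by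
  refine (measureReal_mono ?_).trans (unif_real_avoid_pairs_le n (fun j => j + k) T ?_ ?_ ?_)
  · intro S hS j _ h
    exact hS (Finset.mem_sub.2 ⟨_, h.2, j, h.1, by ring⟩)
  · intro j hj
    have := hT j hj
    rw [mem_ground]; omega
  · intro j hj
    have := hT j hj
    rw [Finset.mem_sdiff, mem_ground]
    exact ⟨by omega, this.2.2.2.2⟩
  · intro x _ y _ h
    simpa using h

/-- Alternating blocks of length `k`: half of `{0, …, n}`, up to one block, is matched by `+ k`. -/
theorem exists_pairs_of_small_difference {n k : ℕ} (hk : 0 < k) :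
    ∃ T : Finset ℤ, (∀ j ∈ T, 0 ≤ j ∧ j ≤ n ∧ 0 ≤ j + k ∧ j + k ≤ n ∧ j + k ∉ T) ∧
      n + 1 ≤ 2 * T.card + k := by
  have hk' : (0 : ℤ) < k := by exact_mod_cast hk
  have hdiv : ∀ j : ℤ, (j + k) / k = j / k + 1 := fun j => by
    rw [Int.add_ediv_of_dvd_right (dvd_refl _), Int.ediv_self hk'.ne']
  -- The blocks are `[qk, (q+1)k)`. Even blocks supply the first members, and `+ k` sends them into
  -- odd blocks.
  refine ⟨(ground n).filter fun j => Even (j / (k : ℤ)) ∧ j + k ≤ n, ?_, ?_⟩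
  · intro j hj
    rw [Finset.mem_filter, mem_ground] at hj
    refine ⟨hj.1.1, hj.1.2, by omega, hj.2.2, fun h => ?_⟩
    rw [Finset.mem_filter, hdiv, Int.even_add_one] at h
    exact h.2.1 hj.2.1
  · set T := (ground n).filter fun j => Even (j / (k : ℤ)) ∧ j + k ≤ n with hT
    have hsub : ground n ⊆ (T ∪ T.image (· + (k : ℤ))) ∪ Finset.Icc ((n : ℤ) - k + 1) n := by
      intro x hx
      rw [mem_ground] at hx
      simp only [Finset.mem_union, Finset.mem_image, Finset.mem_Icc, hT, Finset.mem_filter,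
        mem_ground]
      rcases lt_or_ge (n : ℤ) (x + k) with h | h
      · exact .inr (by omega)
      · refine .inl ?_
        rcases Int.even_or_odd (x / k) with he | ho
        · exact .inl ⟨hx, he, h⟩
        · have hkx : (k : ℤ) ≤ x := by
            by_contra hlt
            rw [Int.ediv_eq_zero_of_lt hx.1 (by omega)] at ho
            simp at ho
          have hd := hdiv (x - k)
          rw [sub_add_cancel] at hd
          rw [hd, ← Int.not_even_iff_odd, Int.even_add_one, not_not] at ho
          exact .inr ⟨x - k, ⟨by omega, ho, by omega⟩, by ring⟩
    have h1 := Finset.card_le_card hsub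
    have h2 := Finset.card_union_le (T ∪ T.image (· + (k : ℤ))) (Finset.Icc ((n : ℤ) - k + 1) n)
    have h3 := Finset.card_union_le T (T.image (· + (k : ℤ)))
    have h4 : (T.image (· + (k : ℤ))).card ≤ T.card := Finset.card_image_le
    rw [Int.card_Icc] at h2
    rw [card_ground] at h1
    omega

/-- The pairs `{j, j + (n - i)}` with `0 ≤ j ≤ i` are disjoint when `i < n - i`, which gives the
first term. Otherwise they chain, but about `n / 3` disjoint ones can still be selected; the second
term pays for this. -/
theorem unif_real_difference_missing_le {n i : ℕ} (hi : i < n) :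
    (unif n).real {S | (n - i : ℤ) ∉ S - S} ≤ (√3 / 2) ^ i + (√3 / 2) ^ (2 * (n / 3)) := by
  have p1 : 0 ≤ (√3 / 2) ^ i := by positivity
  have p2 : 0 ≤ (√3 / 2) ^ (2 * (n / 3)) := by positivity
  rcases le_or_gt (3 * (n - i)) n with h | h
  · obtain ⟨T, hT, hc⟩ := exists_pairs_of_small_difference (n := n) (k := n - i) (by omega)
    rw [Nat.cast_sub hi.le] at hT
    refine (unif_real_difference_missing_le_of_pairs hT).trans
      ((three_quarters_pow_le (k := 2 * (n / 3)) (by omega)).trans (by linarith))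
  -- The interval `[0, b]` is shorter than the shift `n - i`, so it is disjoint from its translate.
  -- If `b = n - i - 1`, it has `n - i > n / 3` elements.
  · set b : ℤ := min (n - i - 1) i with hb
    have hbound := unif_real_difference_missing_le_of_pairs (n := n) (k := n - i)
      (T := Finset.Icc 0 b) (by
        intro j hj
        rw [Finset.mem_Icc] at hj ⊢
        omega)
    rw [Int.card_Icc] at hbound
    rcases le_total (n - i - 1 : ℤ) i with h' | h'
    · exact hbound.trans ((three_quarters_pow_le (k := 2 * (n / 3)) (by omega)).trans (by linarith))
    · exact hbound.trans ((three_quarters_pow_le (k := i) (by omega)).trans (by linarith))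

/-! ### Rich sets -/

/-- All sums and all nonnegative differences at distance more than `a` from the extremes occur. -/
def Rich (n a : ℕ) (S : Finset ℤ) : Prop :=
  (∀ k : ℤ, a < k → k < 2 * n - a → k ∈ S + S) ∧ ∀ k : ℤ, 0 ≤ k → k < n - a → k ∈ S - S

theorem unif_real_not_rich_le_sum {n a : ℕ} (ha : 2 * a < n) (hn : 3 ≤ n) :
    (unif n).real {S | ¬ Rich n a S} ≤
      ∑ i ∈ Finset.Icc (a + 1) n, (3 * (√3 / 2) ^ i + (√3 / 2) ^ (2 * (n / 3))) := by
  have hsub : {S | ¬ Rich n a S} ⊆ ⋃ i ∈ Finset.Icc (a + 1) n,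
      ({S : Finset ℤ | (i : ℤ) ∉ S + S} ∪ {S | (2 * n - i : ℤ) ∉ S + S}) ∪
        {S | i < n ∧ (n - i : ℤ) ∉ S - S} := by
    intro S hS
    by_contra hcon
    simp only [Set.mem_iUnion, Set.mem_union, not_exists, not_or] at hcon
    have hcon' : ∀ i : ℕ, a + 1 ≤ i → i ≤ n → ((i : ℤ) ∈ S + S ∧ (2 * n - i : ℤ) ∈ S + S) ∧
        (i < n → (n - i : ℤ) ∈ S - S) := by
      intro i h1 h2
      obtain ⟨⟨h3, h4⟩, h5⟩ := hcon i (Finset.mem_Icc.2 ⟨h1, h2⟩)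
      exact ⟨⟨not_not.1 h3, not_not.1 h4⟩, fun h => not_not.1 fun h' => h5 ⟨h, h'⟩⟩
    refine hS ⟨fun k h1 h2 => ?_, fun k h1 h2 => ?_⟩
    · rcases le_total k n with h | h
      · lift k to ℕ using by omega
        exact (hcon' k (by omega) (by omega)).1.1
      · have := (hcon' (2 * n - k).toNat (by omega) (by omega)).1.2
        rwa [Int.toNat_of_nonneg (by omega), sub_sub_cancel] at this
    · rcases h1.eq_or_lt with rfl | h
      -- The difference `0` only needs `S` nonempty, which follows from the presence of the sum `n -
      -- 1`.
      · have h1 := (hcon' (n - 1) (by omega) (by omega)).1.1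
        obtain ⟨x, hx, -⟩ := Finset.mem_add.1 h1
        exact Finset.mem_sub.2 ⟨x, hx, x, hx, sub_self x⟩
      · have := (hcon' (n - k).toNat (by omega) (by omega)).2 (by omega)
        rwa [Int.toNat_of_nonneg (by omega), sub_sub_cancel] at this
  refine (measureReal_mono hsub (measure_ne_top _ _)).trans ((measureReal_biUnion_finset_le _ _).trans
    (Finset.sum_le_sum fun i hi => ?_))
  rw [Finset.mem_Icc] at hi
  refine (measureReal_union_le _ _).trans ?_
  have h1 := measureReal_union_le (μ := unif n) {S : Finset ℤ | (i : ℤ) ∉ S + S}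
    {S | (2 * n - i : ℤ) ∉ S + S}
  have h2 := unif_real_low_sum_missing_le hi.2
  have h3 := unif_real_high_sum_missing_le hi.2
  have h4 : (unif n).real {S | i < n ∧ (n - i : ℤ) ∉ S - S} ≤
      (√3 / 2) ^ i + (√3 / 2) ^ (2 * (n / 3)) := by
    by_cases h : i < n
    · exact (measureReal_mono fun S hS => hS.2).trans (unif_real_difference_missing_le h)
    · simp only [h, false_and]
      have : (unif n).real {S : Finset ℤ | False} = 0 := measureReal_empty
      rw [this]
      positivity
  linarith

/-- The total of the `n` error terms is absorbed into `(√3/2)^a`: since `a < n / 2 < 2n / 3`, a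
spare exponent of about `n / 12` beats the factor `n`. -/
theorem eventually_mul_pow_le :
    ∀ᶠ n : ℕ in atTop, ∀ a : ℕ, 2 * a < n →
      n * (√3 / 2) ^ (2 * (n / 3)) ≤ (√3 / 2) ^ a := by
  have ht : Tendsto (fun q : ℕ => (q : ℝ) * (√3 / 2) ^ q) atTop (𝓝 0) :=
    tendsto_self_mul_const_pow_of_lt_one sqrt_three_div_two_pos.le sqrt_three_div_two_lt_one
  have hdiv : Tendsto (fun n : ℕ => n / 12) atTop atTop := Nat.tendsto_div_const_atTop (by norm_num)
  have hev : ∀ᶠ n : ℕ in atTop, ((n / 12 : ℕ) : ℝ) * (√3 / 2) ^ (n / 12) < 1 / 24 :=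
    hdiv.eventually (ht.eventually_lt_const (by norm_num))
  filter_upwards [hev, eventually_ge_atTop 48] with n hn hn' a ha
  have e1 : a + n / 12 ≤ 2 * (n / 3) := by omega
  have e2 : n ≤ 24 * (n / 12) := by omega
  have e2' : (n : ℝ) ≤ 24 * (n / 12 : ℕ) := by exact_mod_cast e2
  have p : 0 ≤ (√3 / 2) ^ (n / 12) := by positivity
  have p' : 0 ≤ (√3 / 2) ^ a := by positivity
  calc n * (√3 / 2) ^ (2 * (n / 3)) ≤ n * (√3 / 2) ^ (a + n / 12) := by
        gcongr ?_ * ?_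
        exact pow_le_pow_of_le_one sqrt_three_div_two_pos.le sqrt_three_div_two_lt_one.le e1
    _ = (√3 / 2) ^ a * (n * (√3 / 2) ^ (n / 12)) := by rw [pow_add]; ring
    _ ≤ (√3 / 2) ^ a * 1 := by
        gcongr
        nlinarith
    _ = _ := mul_one _

/-- With `r = √3/2`, the geometric series contributes `3 r^a / (1 - r)` and the error terms at most
one more `r^a / (1 - r)`; moreover `4 / (1 - r) = 8 / (2 - √3)`. -/
theorem eventually_unif_real_not_rich_le :
    ∀ᶠ n : ℕ in atTop, ∀ a : ℕ, 2 * a < n →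
      (unif n).real {S | ¬ Rich n a S} ≤ 8 * (√3 / 2) ^ a / (2 - √3) := by
  filter_upwards [eventually_mul_pow_le, eventually_ge_atTop 3] with n hn hn3 a ha
  refine (unif_real_not_rich_le_sum ha hn3).trans ?_
  have r0 := sqrt_three_div_two_pos
  have r1 := sqrt_three_div_two_lt_one
  have hgeom : ∑ i ∈ Finset.Icc (a + 1) n, (√3 / 2) ^ i ≤ (√3 / 2) ^ a / (1 - √3 / 2) := by
    have h := geom_sum_Ico_le_of_lt_one (m := a + 1) (n := n + 1) r0.le r1
    have e : Finset.Icc (a + 1) n = Finset.Ico (a + 1) (n + 1) := by ext; simp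
    rw [e]
    refine h.trans ?_
    have : 0 < 1 - √3 / 2 := by linarith
    gcongr ?_ / _
    exact pow_le_pow_of_le_one r0.le r1.le (by omega)
  have hcard : ((Finset.Icc (a + 1) n).card : ℝ) ≤ n := by
    rw [Nat.card_Icc]; norm_cast; omega
  have p : 0 ≤ (√3 / 2) ^ (2 * (n / 3)) := by positivity
  have hn' := hn a ha
  have hle : (√3 / 2) ^ a ≤ (√3 / 2) ^ a / (1 - √3 / 2) :=
    le_div_self (by positivity) (by linarith) (by linarith)
  rw [Finset.sum_add_distrib, ← Finset.mul_sum, Finset.sum_const, nsmul_eq_mul]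
  have e : 8 * (√3 / 2) ^ a / (2 - √3) = 4 * ((√3 / 2) ^ a / (1 - √3 / 2)) := by
    have h1 : (1 - √3 / 2) ≠ 0 := by linarith
    have h2 : (2 - √3) ≠ 0 := by linarith
    field_simp
    norm_num
  rw [e]
  have := mul_le_mul_of_nonneg_right hcard p
  linarith

/-! ### Fringes determine the missing sums and differences -/

/-- The trace of `S` on `{0, …, a}`. -/
noncomputable def lowFringe (a : ℕ) (S : Finset ℤ) : Finset ℤ := (Finset.Icc 0 (a : ℤ)).filter (· ∈ S)

/-- The trace of `S` on `{n - a, …, n}`, reflected to `{0, …, a}`. -/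
noncomputable def highFringe (n a : ℕ) (S : Finset ℤ) : Finset ℤ :=
  (Finset.Icc 0 (a : ℤ)).filter fun x => (n : ℤ) - x ∈ S

/-- The elements of `{0, …, a}` that are not of the form `x + y` with `x ∈ A` and `y ∈ B`. -/
noncomputable def gaps (a : ℕ) (A B : Finset ℤ) : Finset ℤ := (Finset.Icc 0 (a : ℤ)).filter (· ∉ A + B)

/-- The numbers of missing sums and differences at the two extremes, in terms of the two fringes. -/
noncomputable def fringeMissing (a : ℕ) (A B : Finset ℤ) : ℕ × ℕ :=
  ((gaps a A A).card + (gaps a B B).card, 2 * (gaps a A B).card)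

theorem mem_lowFringe {a : ℕ} {S : Finset ℤ} {x : ℤ} :
    x ∈ lowFringe a S ↔ (0 ≤ x ∧ x ≤ a) ∧ x ∈ S := by
  rw [lowFringe, Finset.mem_filter, Finset.mem_Icc]

theorem mem_highFringe {n a : ℕ} {S : Finset ℤ} {x : ℤ} :
    x ∈ highFringe n a S ↔ (0 ≤ x ∧ x ≤ a) ∧ (n : ℤ) - x ∈ S := by
  rw [highFringe, Finset.mem_filter, Finset.mem_Icc]

theorem mem_gaps {a : ℕ} {A B : Finset ℤ} {x : ℤ} :
    x ∈ gaps a A B ↔ (0 ≤ x ∧ x ≤ a) ∧ x ∉ A + B := by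
  rw [gaps, Finset.mem_filter, Finset.mem_Icc]

theorem low_sum_mem_iff {n a : ℕ} {S : Finset ℤ} (hS : S ⊆ ground n) {k : ℤ} (hk : k ≤ a) :
    k ∈ S + S ↔ k ∈ lowFringe a S + lowFringe a S := by
  simp only [Finset.mem_add, mem_lowFringe]
  constructor
  · rintro ⟨x, hx, y, hy, rfl⟩
    have h1 := mem_ground.1 (hS hx)
    have h2 := mem_ground.1 (hS hy)
    exact ⟨x, ⟨by omega, hx⟩, y, ⟨by omega, hy⟩, rfl⟩
  · rintro ⟨x, hx, y, hy, rfl⟩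
    exact ⟨x, hx.2, y, hy.2, rfl⟩

theorem high_sum_mem_iff {n a : ℕ} {S : Finset ℤ} (hS : S ⊆ ground n) {k : ℤ} (hk : k ≤ a) :
    2 * n - k ∈ S + S ↔ k ∈ highFringe n a S + highFringe n a S := by
  simp only [Finset.mem_add, mem_highFringe]
  constructor
  · rintro ⟨x, hx, y, hy, h⟩
    have h1 := mem_ground.1 (hS hx)
    have h2 := mem_ground.1 (hS hy)
    exact ⟨n - x, ⟨by omega, by rwa [sub_sub_cancel]⟩, n - y, ⟨by omega, by rwa [sub_sub_cancel]⟩,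
      by omega⟩
  · rintro ⟨x, hx, y, hy, rfl⟩
    exact ⟨_, hx.2, _, hy.2, by ring⟩

/-- `n - k = x - y` means `k = y + (n - x)` with both summands nonnegative, so differences near `n`
are sums of the low fringe and the reflected high fringe. -/
theorem difference_mem_iff {n a : ℕ} {S : Finset ℤ} (hS : S ⊆ ground n) {k : ℤ} (hk : k ≤ a) :
    n - k ∈ S - S ↔ k ∈ lowFringe a S + highFringe n a S := by
  simp only [Finset.mem_add, Finset.mem_sub, mem_lowFringe, mem_highFringe]
  constructor
  · rintro ⟨x, hx, y, hy, h⟩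
    have h1 := mem_ground.1 (hS hx)
    have h2 := mem_ground.1 (hS hy)
    exact ⟨y, ⟨by omega, hy⟩, n - x, ⟨by omega, by rwa [sub_sub_cancel]⟩, by omega⟩
  · rintro ⟨x, hx, y, hy, rfl⟩
    exact ⟨_, hy.2, _, hx.2, by ring⟩

theorem neg_mem_sub_self {S : Finset ℤ} {k : ℤ} : -k ∈ S - S ↔ k ∈ S - S := by
  simp only [Finset.mem_sub]
  constructor
  · rintro ⟨x, hx, y, hy, h⟩; exact ⟨y, hy, x, hx, by omega⟩
  · rintro ⟨x, hx, y, hy, h⟩; exact ⟨y, hy, x, hx, by omega⟩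

theorem missing_sums_eq {n a : ℕ} {S : Finset ℤ} (hS : S ⊆ ground n) (ha : 2 * a < n)
    (hR : Rich n a S) :
    2 * n + 1 - (S + S).card =
      (gaps a (lowFringe a S) (lowFringe a S)).card +
        (gaps a (highFringe n a S) (highFringe n a S)).card := by
  have hsub : S + S ⊆ Finset.Icc (0 : ℤ) (2 * n) := by
    intro x hx
    obtain ⟨a, ha, b, hb, rfl⟩ := Finset.mem_add.1 hx
    have h1 := mem_ground.1 (hS ha)
    have h2 := mem_ground.1 (hS hb)
    exact Finset.mem_Icc.2 ⟨by omega, by omega⟩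
  have h1 : 2 * n + 1 - (S + S).card = (Finset.Icc (0 : ℤ) (2 * n) \ (S + S)).card := by
    rw [Finset.card_sdiff_of_subset hsub, Int.card_Icc]
    omega
  have h2 : Finset.Icc (0 : ℤ) (2 * n) \ (S + S) =
      gaps a (lowFringe a S) (lowFringe a S) ∪
        (gaps a (highFringe n a S) (highFringe n a S)).image (fun k => 2 * (n : ℤ) - k) := by
    ext k
    simp only [Finset.mem_sdiff, Finset.mem_Icc, Finset.mem_union, Finset.mem_image, mem_gaps]
    constructor
    · rintro ⟨hk, hkS⟩
      rcases le_or_gt k a with h | h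
      · exact .inl ⟨by omega, fun h' => hkS ((low_sum_mem_iff hS h).2 h')⟩
      · rcases lt_or_ge k (2 * n - a) with h' | h'
        · exact absurd (hR.1 k h h') hkS
        · refine .inr ⟨2 * n - k, ⟨by omega, fun h3 => hkS ?_⟩, by ring⟩
          rwa [← high_sum_mem_iff hS (by omega), sub_sub_cancel] at h3
    · rintro (⟨hk, hkS⟩ | ⟨j, ⟨hj, hjS⟩, rfl⟩)
      · exact ⟨by omega, fun h => hkS ((low_sum_mem_iff hS hk.2).1 h)⟩
      · exact ⟨by omega, fun h => hjS ((high_sum_mem_iff hS hj.2).1 h)⟩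
  rw [h1, h2, Finset.card_union_of_disjoint, Finset.card_image_of_injective]
  · intro x y h
    simpa using h
  · rw [Finset.disjoint_left]
    intro k hk hk'
    simp only [Finset.mem_image, mem_gaps] at hk hk'
    obtain ⟨j, ⟨hj, -⟩, rfl⟩ := hk'
    omega

/-- `S - S` is symmetric, and the missing differences are nonzero because `a < n`; they therefore
come in pairs `±(n - k)`, whence the factor two. -/
theorem missing_differences_eq {n a : ℕ} {S : Finset ℤ} (hS : S ⊆ ground n) (ha : 2 * a < n)
    (hR : Rich n a S) :
    2 * n + 1 - (S - S).card = 2 * (gaps a (lowFringe a S) (highFringe n a S)).card := by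
  have hsub : S - S ⊆ Finset.Icc (-n : ℤ) n := by
    intro x hx
    obtain ⟨a, ha, b, hb, rfl⟩ := Finset.mem_sub.1 hx
    have h1 := mem_ground.1 (hS ha)
    have h2 := mem_ground.1 (hS hb)
    exact Finset.mem_Icc.2 ⟨by omega, by omega⟩
  have h1 : 2 * n + 1 - (S - S).card = (Finset.Icc (-n : ℤ) n \ (S - S)).card := by
    rw [Finset.card_sdiff_of_subset hsub, Int.card_Icc]
    omega
  set Z := gaps a (lowFringe a S) (highFringe n a S) with hZ
  have h2 : Finset.Icc (-n : ℤ) n \ (S - S) =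
      Z.image (fun k => (n : ℤ) - k) ∪ Z.image (fun k => -((n : ℤ) - k)) := by
    ext k
    simp only [Finset.mem_sdiff, Finset.mem_Icc, Finset.mem_union, Finset.mem_image, hZ, mem_gaps]
    constructor
    · rintro ⟨hk, hkS⟩
      rcases le_total 0 k with h | h
      · rcases lt_or_ge k (n - a) with h' | h'
        · exact absurd (hR.2 k h h') hkS
        · refine .inl ⟨n - k, ⟨by omega, fun h3 => hkS ?_⟩, by ring⟩
          rwa [← difference_mem_iff hS (by omega), sub_sub_cancel] at h3
      · rw [← neg_mem_sub_self] at hkS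
        rcases lt_or_ge (-k) (n - a) with h' | h'
        · exact absurd (hR.2 (-k) (by omega) h') hkS
        · refine .inr ⟨n - -k, ⟨by omega, fun h3 => hkS ?_⟩, by ring⟩
          rwa [← difference_mem_iff hS (by omega), sub_sub_cancel] at h3
    · rintro (⟨j, ⟨hj, hjS⟩, rfl⟩ | ⟨j, ⟨hj, hjS⟩, rfl⟩)
      · exact ⟨by omega, fun h => hjS ((difference_mem_iff hS hj.2).1 h)⟩
      · exact ⟨by omega, fun h => hjS ((difference_mem_iff hS hj.2).1 (neg_mem_sub_self.1 h))⟩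
  rw [h1, h2, Finset.card_union_of_disjoint, Finset.card_image_of_injective,
    Finset.card_image_of_injective, two_mul]
  · intro x y h
    simpa using h
  · intro x y h
    simpa using h
  · rw [Finset.disjoint_left]
    intro k hk hk'
    simp only [Finset.mem_image, hZ, mem_gaps] at hk hk'
    obtain ⟨i, ⟨hi, -⟩, rfl⟩ := hk
    obtain ⟨j, ⟨hj, -⟩, h⟩ := hk'
    omega

theorem missing_eq_fringeMissing {n a : ℕ} {S : Finset ℤ} (hS : S ⊆ ground n) (ha : 2 * a < n)
    (hR : Rich n a S) : missing n S = fringeMissing a (lowFringe a S) (highFringe n a S) :=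
  Prod.ext (missing_sums_eq hS ha hR) (missing_differences_eq hS ha hR)

/-- The event that the fringes of `S` prescribe a pair in `Λ`. -/
def fringeEvent (Λ : Set (ℕ × ℕ)) (n a : ℕ) : Set (Finset ℤ) :=
  {S | fringeMissing a (lowFringe a S) (highFringe n a S) ∈ Λ}

theorem dependsOnlyOn_fringeEvent (Λ : Set (ℕ × ℕ)) (n a : ℕ) :
    DependsOnlyOn n (Finset.Icc 0 (a : ℤ) ∪ Finset.Icc ((n : ℤ) - a) n) (fringeEvent Λ n a) := by
  intro S T _ _ h
  have hmem : ∀ x : ℤ, (0 ≤ x ∧ x ≤ a) ∨ ((n : ℤ) - a ≤ x ∧ x ≤ n) → (x ∈ S ↔ x ∈ T) := by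
    intro x hx
    have hx' : x ∈ Finset.Icc 0 (a : ℤ) ∪ Finset.Icc ((n : ℤ) - a) n := by
      simpa only [Finset.mem_union, Finset.mem_Icc] using hx
    have := Finset.ext_iff.1 h x
    simpa only [Finset.mem_inter, hx', and_true] using this
  have h1 : lowFringe a S = lowFringe a T := by
    ext x
    rw [mem_lowFringe, mem_lowFringe]
    exact and_congr_right fun hx => hmem x (.inl hx)
  have h2 : highFringe n a S = highFringe n a T := by
    ext x
    rw [mem_highFringe, mem_highFringe]
    exact and_congr_right fun hx => hmem _ (.inr (by omega))
  change _ ∈ Λ ↔ _ ∈ Λ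
  rw [h1, h2]

theorem middle_union_fringe {n a : ℕ} (ha : 2 * a < n) :
    Finset.Icc ((a : ℤ) + 1) (n - a - 1) ∪ (Finset.Icc 0 (a : ℤ) ∪ Finset.Icc ((n : ℤ) - a) n) =
      ground n := by
  ext x
  simp only [Finset.mem_union, Finset.mem_Icc, mem_ground]
  omega

theorem disjoint_middle_fringe (n a : ℕ) :
    Disjoint (Finset.Icc ((a : ℤ) + 1) (n - a - 1))
      (Finset.Icc 0 (a : ℤ) ∪ Finset.Icc ((n : ℤ) - a) n) := by
  rw [Finset.disjoint_left]
  intro x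
  simp only [Finset.mem_union, Finset.mem_Icc]
  omega

/-- The probability of a fringe event does not depend on `n`. -/
theorem unif_real_fringeEvent (Λ : Set (ℕ × ℕ)) (a : ℕ) :
    ∃ q : ℝ, ∀ n : ℕ, 2 * a < n → (unif n).real (fringeEvent Λ n a) = q := by
  classical
  set I : Finset ℤ := Finset.Icc 0 (a : ℤ) with hI
  -- The constant is the proportion of admissible pairs of fringes, each a subset of `{0, …, a}`;
  -- the middle part contributes a power of two that cancels.
  refine ⟨((I.powerset ×ˢ I.powerset).filter fun P => fringeMissing a P.1 P.2 ∈ Λ).card /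
    2 ^ (2 * a + 2), fun n ha => ?_⟩
  set M : Finset ℤ := Finset.Icc ((a : ℤ) + 1) (n - a - 1)
  set V : Finset ℤ := I ∪ Finset.Icc ((n : ℤ) - a) n with hV
  have h := countSubsets_union (disjoint_middle_fringe n a) (fun _ => True) (· ∈ fringeEvent Λ n a)
  have hM : M.card = n - 2 * a - 1 := by rw [Int.card_Icc]; omega
  rw [countSubsets_true, middle_union_fringe ha, hM] at h
  have hc : countSubsets V (· ∈ fringeEvent Λ n a) =
      ((I.powerset ×ˢ I.powerset).filter fun P => fringeMissing a P.1 P.2 ∈ Λ).card := by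
    have hmemV : ∀ {x : ℤ}, x ∈ V ↔ (0 ≤ x ∧ x ≤ a) ∨ ((n : ℤ) - a ≤ x ∧ x ≤ n) := by
      intro x
      simp only [hV, hI, Finset.mem_union, Finset.mem_Icc]
    have key : ∀ P : Finset ℤ × Finset ℤ, P.1 ⊆ I → P.2 ⊆ I →
        lowFringe a (P.1 ∪ P.2.image fun x => (n : ℤ) - x) = P.1 ∧
          highFringe n a (P.1 ∪ P.2.image fun x => (n : ℤ) - x) = P.2 := by
      intro P h1 h2
      have h1' : ∀ x ∈ P.1, 0 ≤ x ∧ x ≤ a := fun x hx => Finset.mem_Icc.1 (h1 hx)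
      have h2' : ∀ x ∈ P.2, 0 ≤ x ∧ x ≤ a := fun x hx => Finset.mem_Icc.1 (h2 hx)
      constructor
      · ext x
        simp only [mem_lowFringe, Finset.mem_union, Finset.mem_image]
        constructor
        · rintro ⟨hx, h | ⟨y, hy, rfl⟩⟩
          · exact h
          · have := h2' y hy; omega
        · exact fun hx => ⟨h1' x hx, .inl hx⟩
      · ext x
        simp only [mem_highFringe, Finset.mem_union, Finset.mem_image]
        constructor
        · rintro ⟨hx, h | ⟨y, hy, h⟩⟩
          · have := h1' _ h; omega
          · obtain rfl : y = x := by omega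
            exact hy
        · exact fun hx => ⟨h2' x hx, .inr ⟨x, hx, rfl⟩⟩
    refine Finset.card_bij' (fun S _ => (lowFringe a S, highFringe n a S))
      (fun P _ => P.1 ∪ P.2.image fun x => (n : ℤ) - x) ?_ ?_ ?_ ?_
    · intro S hS
      rw [Finset.mem_filter] at hS
      rw [Finset.mem_filter, Finset.mem_product, Finset.mem_powerset, Finset.mem_powerset]
      exact ⟨⟨Finset.filter_subset _ _, Finset.filter_subset _ _⟩, hS.2⟩
    · intro P hP
      rw [Finset.mem_filter, Finset.mem_product, Finset.mem_powerset, Finset.mem_powerset] at hP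
      obtain ⟨k1, k2⟩ := key P hP.1.1 hP.1.2
      rw [Finset.mem_filter, Finset.mem_powerset]
      refine ⟨Finset.union_subset (hP.1.1.trans Finset.subset_union_left) ?_, ?_⟩
      · intro x hx
        obtain ⟨y, hy, rfl⟩ := Finset.mem_image.1 hx
        have := Finset.mem_Icc.1 (hP.1.2 hy)
        rw [hmemV]; omega
      · change fringeMissing a _ _ ∈ Λ
        rw [k1, k2]
        exact hP.2
    · intro S hS
      rw [Finset.mem_filter, Finset.mem_powerset] at hS
      ext x
      simp only [Finset.mem_union, Finset.mem_image, mem_lowFringe, mem_highFringe]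
      constructor
      · rintro (h | ⟨y, ⟨-, h⟩, rfl⟩)
        · exact h.2
        · exact h
      · intro hx
        rcases hmemV.1 (hS.1 hx) with h | h
        · exact .inl ⟨h, hx⟩
        · exact .inr ⟨n - x, ⟨by omega, by rwa [sub_sub_cancel]⟩, by ring⟩
    · intro P hP
      rw [Finset.mem_filter, Finset.mem_product, Finset.mem_powerset, Finset.mem_powerset] at hP
      obtain ⟨k1, k2⟩ := key P hP.1.1 hP.1.2
      exact Prod.ext k1 k2
  have hdep : countSubsets (ground n) (· ∈ fringeEvent Λ n a) =
      countSubsets (ground n) (fun S => True ∧ S ∩ V ∈ fringeEvent Λ n a) :=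
    countSubsets_congr fun S hS => by
      rw [true_and]
      exact dependsOnlyOn_fringeEvent Λ n a S (S ∩ V) hS (Finset.inter_subset_left.trans hS)
        (by rw [Finset.inter_assoc, ← hI, ← hV, Finset.inter_self])
  rw [unif_real, hdep, h, hc]
  have hpow : (2 : ℝ) ^ (n + 1) = 2 ^ (n - 2 * a - 1) * 2 ^ (2 * a + 2) := by
    rw [← pow_add]; congr 1; omega
  rw [hpow]
  push_cast
  rw [mul_div_mul_left _ _ (by positivity)]

/-! ### Existence of the limit -/

/-- On rich sets the event `λₙ(S) ∈ Λ` is the fringe event. -/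
theorem mem_charEvent_iff {Λ : Set (ℕ × ℕ)} {n a : ℕ} {S : Finset ℤ} (hS : S ⊆ ground n)
    (ha : 2 * a < n) (hR : Rich n a S) : S ∈ charEvent Λ n ↔ S ∈ fringeEvent Λ n a := by
  change missing n S ∈ Λ ↔ _ ∈ Λ
  rw [missing_eq_fringeMissing hS ha hR]

theorem abs_unif_real_sub_le_of_rich {n a : ℕ} {E F : Set (Finset ℤ)}
    (h : ∀ S ⊆ ground n, Rich n a S → (S ∈ E ↔ S ∈ F)) :
    |(unif n).real E - (unif n).real F| ≤ (unif n).real {S | ¬ Rich n a S} := by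
  have key : ∀ A B : Set (Finset ℤ), (∀ S ⊆ ground n, Rich n a S → S ∈ A → S ∈ B) →
      (unif n).real A ≤ (unif n).real B + (unif n).real {S | ¬ Rich n a S} := by
    intro A B hAB
    refine (unif_real_mono (F := B ∪ {S | ¬ Rich n a S}) fun S hS hA => ?_).trans
      (measureReal_union_le _ _)
    by_cases hR : Rich n a S
    · exact .inl (hAB S hS hR hA)
    · exact .inr hR
  have h1 := key E F fun S hS hR => (h S hS hR).1
  have h2 := key F E fun S hS hR => (h S hS hR).2
  rw [abs_le]
  constructor <;> linarith

/-- For fixed `a`, all late `rho Λ n` lie near the same fringe probability `q`, with an error that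
is small for large `a`. Hence the sequence is Cauchy. -/
theorem exists_tendsto_rho (Λ : Set (ℕ × ℕ)) : ∃ ρ : ℝ, Tendsto (rho Λ) atTop (𝓝 ρ) := by
  refine cauchySeq_tendsto_of_complete (Metric.cauchySeq_iff'.2 fun ε hε => ?_)
  have hlim : Tendsto (fun a : ℕ => 2 * (8 * (√3 / 2) ^ a / (2 - √3))) atTop (𝓝 0) := by
    have := tendsto_pow_atTop_nhds_zero_of_lt_one sqrt_three_div_two_pos.le
      sqrt_three_div_two_lt_one
    simpa using ((this.const_mul 8).div_const (2 - √3)).const_mul 2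
  obtain ⟨a, ha⟩ := (hlim.eventually_lt_const hε).exists
  obtain ⟨q, hq⟩ := unif_real_fringeEvent Λ a
  obtain ⟨N, hN⟩ := eventually_atTop.1
    (eventually_unif_real_not_rich_le.and (eventually_gt_atTop (2 * a)))
  have hclose : ∀ n ≥ N, |rho Λ n - q| ≤ 8 * (√3 / 2) ^ a / (2 - √3) := by
    intro n hn
    obtain ⟨h1, h2⟩ := hN n hn
    rw [← hq n h2, rho_eq_unif_real]
    exact (abs_unif_real_sub_le_of_rich fun S hS hR => mem_charEvent_iff hS h2 hR).trans (h1 a h2)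
  refine ⟨N, fun n hn => ?_⟩
  rw [Real.dist_eq]
  have h1 := abs_le.1 (hclose n hn)
  have h2 := abs_le.1 (hclose N le_rfl)
  refine lt_of_le_of_lt (abs_le.2 ⟨?_, ?_⟩) ha <;> linarith

/-! ### Positivity of the limit -/

/-- Every pair `(s, 2 e)` is prescribed by a pair of cofinite fringes. -/
theorem exists_fringes (s e : ℕ) :
    ∃ (M : ℕ) (A B : Set ℤ), (∀ x : ℤ, M < x → x ∈ A ∧ x ∈ B) ∧
      ∀ b : ℕ, M ≤ b → ∀ A' B' : Finset ℤ, (∀ x, x ∈ A' ↔ (0 ≤ x ∧ x ≤ b) ∧ x ∈ A) →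
        (∀ x, x ∈ B' ↔ (0 ≤ x ∧ x ≤ b) ∧ x ∈ B) → fringeMissing b A' B' = (s, 2 * e) := by
  -- With `L > s + e`, the blocks of `A` make `A + A` miss only `1, …, s`, and `B + B` misses
  -- nothing. The bounded blocks give `A + B` everything up to `13L - 2` and then nothing before
  -- `14L`; the tails start at `13L - 1 + e`, leaving exactly `e` gaps.
  set L : ℕ := s + e + 1 with hL
  refine ⟨13 * L + e,
    {x | x = 0 ∨ (s < x ∧ x < 3 * L) ∨ (5 * L ≤ x ∧ x < 8 * L) ∨ 13 * (L : ℤ) - 1 + e ≤ x},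
    {x | x < 5 * L ∨ (9 * L ≤ x ∧ x < 10 * L) ∨ 13 * (L : ℤ) - 1 + e ≤ x}, ?_, ?_⟩
  · intro x hx
    push_cast at hx
    exact ⟨.inr (.inr (.inr (by omega))), .inr (.inr (by omega))⟩
  intro b hb A' B' hA hB
  replace hA : ∀ x, x ∈ A' ↔ (0 ≤ x ∧ x ≤ b) ∧
    (x = 0 ∨ (s < x ∧ x < 3 * L) ∨ (5 * L ≤ x ∧ x < 8 * L) ∨ 13 * (L : ℤ) - 1 + e ≤ x) := hA
  replace hB : ∀ x, x ∈ B' ↔ (0 ≤ x ∧ x ≤ b) ∧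
    (x < 5 * L ∨ (9 * L ≤ x ∧ x < 10 * L) ∨ 13 * (L : ℤ) - 1 + e ≤ x) := hB
  have hAA : gaps b A' A' = Finset.Icc 1 (s : ℤ) := by
    ext k
    rw [mem_gaps, Finset.mem_Icc]
    constructor
    · rintro ⟨hk, hkA⟩
      by_contra hcon
      have no : ∀ x : ℤ, ¬ (x ∈ A' ∧ k - x ∈ A') := fun x hx =>
        hkA (Finset.mem_add.2 ⟨x, hx.1, _, hx.2, by ring⟩)
      simp only [hA] at no
      -- These few first summands `x`, one or more per pair of blocks, suffice to represent every
      -- `k` outside the gaps.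
      have n0 := no 0
      have n1 := no L
      have n2 := no (2 * L)
      have n5 := no (5 * L)
      have n7 := no (7 * L)
      clear no hkA hA hB
      omega
    · intro hk
      refine ⟨by omega, fun h => ?_⟩
      obtain ⟨x, hx, y, hy, hxy⟩ := Finset.mem_add.1 h
      rw [hA] at hx hy
      omega
  have hBB : gaps b B' B' = ∅ := by
    ext k
    rw [mem_gaps]
    refine ⟨?_, fun h => absurd h (Finset.notMem_empty k)⟩
    rintro ⟨hk, hkB⟩
    exfalso
    have no : ∀ x : ℤ, ¬ (x ∈ B' ∧ k - x ∈ B') := fun x hx =>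
      hkB (Finset.mem_add.2 ⟨x, hx.1, _, hx.2, by ring⟩)
    simp only [hB] at no
    have n0 := no 0
    have n4 := no (4 * L)
    have n9 := no (9 * L)
    clear no hkB hA hB
    omega
  have hAB : gaps b A' B' = Finset.Icc (13 * (L : ℤ) - 1) (13 * L - 2 + e) := by
    ext k
    rw [mem_gaps, Finset.mem_Icc]
    constructor
    · rintro ⟨hk, hkA⟩
      by_contra hcon
      have no : ∀ x : ℤ, ¬ (x ∈ A' ∧ k - x ∈ B') := fun x hx =>
        hkA (Finset.mem_add.2 ⟨x, hx.1, _, hx.2, by ring⟩)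
      simp only [hA, hB] at no
      have n0 := no 0
      have nk := no k
      have n7 := no (7 * L)
      have n8 := no (8 * L - 1)
      clear no hkA hA hB
      omega
    · intro hk
      refine ⟨by omega, fun h => ?_⟩
      obtain ⟨x, hx, y, hy, hxy⟩ := Finset.mem_add.1 h
      rw [hA] at hx
      rw [hB] at hy
      omega
  rw [fringeMissing, hAA, hBB, hAB, Int.card_Icc, Int.card_Icc, Finset.card_empty]
  exact Prod.ext (by simp) (by simp only; omega)

/-- Gluing prescribed fringes to a rich middle part embeds the rich sets, up to their fringes,
into the sets with the prescribed numbers of missing sums and differences. -/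
theorem countSubsets_rich_le {Λ : Set (ℕ × ℕ)} {M c n : ℕ} {A B : Set ℤ}
    (hAB : ∀ x : ℤ, M < x → x ∈ A ∧ x ∈ B)
    (hΛ : ∀ A' B' : Finset ℤ,
      (∀ x, x ∈ A' ↔ (0 ≤ x ∧ x ≤ (c + 2 * M + 2 : ℕ)) ∧ x ∈ A) →
      (∀ x, x ∈ B' ↔ (0 ≤ x ∧ x ≤ (c + 2 * M + 2 : ℕ)) ∧ x ∈ B) →
        fringeMissing (c + 2 * M + 2) A' B' ∈ Λ)
    (hn : 2 * (c + 2 * M + 2) < n + 2 * M + 2) :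
    countSubsets (ground n) (Rich n c) ≤
      countSubsets (ground (n + 2 * M + 2)) (· ∈ charEvent Λ (n + 2 * M + 2)) *
        (2 ^ (c + 2 * M + 3) * 2 ^ (c + 2 * M + 3)) := by
  classical
  -- Shifting by `M + 1` moves sums by `2M + 2`, and `N - n = 2M + 2`; so a set rich at depth `c`
  -- becomes rich at depth exactly `b`.
  set b : ℕ := c + 2 * M + 2 with hb
  set N : ℕ := n + 2 * M + 2 with hN
  have hNn : (N : ℤ) = n + 2 * M + 2 := by rw [hN]; push_cast; ring
  have hbc : (b : ℤ) = c + 2 * M + 2 := by rw [hb]; push_cast; ring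
  set f : Finset ℤ → Finset ℤ := fun T => (ground N).filter fun x =>
    (x ≤ b ∧ x ∈ A) ∨ ((N : ℤ) - x ≤ b ∧ (N : ℤ) - x ∈ B) ∨ x - (M + 1) ∈ T with hf
  have mem_f : ∀ T x, x ∈ f T ↔ (0 ≤ x ∧ x ≤ N) ∧
      ((x ≤ b ∧ x ∈ A) ∨ ((N : ℤ) - x ≤ b ∧ (N : ℤ) - x ∈ B) ∨ x - (M + 1) ∈ T) := by
    intro T x
    rw [hf, Finset.mem_filter, mem_ground]
  have f_char : ∀ T ⊆ ground n, Rich n c T → f T ∈ charEvent Λ N := by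
    intro T hT hR
    have hT' : ∀ x ∈ T, 0 ≤ x ∧ x ≤ n := fun x hx => mem_ground.1 (hT hx)
    have shift : ∀ x ∈ T, x + (M + 1) ∈ f T := by
      intro x hx
      have := hT' x hx
      rw [mem_f]
      exact ⟨by omega, .inr (.inr (by rwa [add_sub_cancel_right]))⟩
    have hfR : Rich N b (f T) := by
      constructor
      · intro k h1 h2
        obtain ⟨x, hx, y, hy, h⟩ :=
          Finset.mem_add.1 (hR.1 (k - 2 * (M + 1)) (by omega) (by omega))
        exact Finset.mem_add.2 ⟨_, shift x hx, _, shift y hy, by linarith⟩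
      · intro k h1 h2
        obtain ⟨x, hx, y, hy, h⟩ := Finset.mem_sub.1 (hR.2 k h1 (by omega))
        exact Finset.mem_sub.2 ⟨_, shift x hx, _, shift y hy, by linarith⟩
    rw [mem_charEvent_iff (Finset.filter_subset _ _) (by omega) hfR]
    refine hΛ _ _ (fun x => ?_) (fun x => ?_)
    · rw [mem_lowFringe, mem_f]
      refine and_congr_right fun hx => ⟨?_, fun h => ⟨by omega, .inl ⟨hx.2, h⟩⟩⟩
      rintro ⟨-, h | h | h⟩
      · exact h.2
      · omega
      · have := hT' _ h
        -- The shifted copy of `T` starts above `M`, where `A` contains everything, so it does not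
        -- alter the prescribed fringe.
        exact (hAB x (by omega)).1
    · rw [mem_highFringe, mem_f, sub_sub_cancel]
      refine and_congr_right fun hx => ⟨?_, fun h => ⟨by omega, .inr (.inl ⟨hx.2, h⟩)⟩⟩
      rintro ⟨-, h | h | h⟩
      · omega
      · exact h.2
      · have := hT' _ h
        exact (hAB x (by omega)).2
  have hcard : (2 : ℕ) ^ (c + 2 * M + 3) = (Finset.Icc 0 (b : ℤ)).powerset.card := by
    rw [Finset.card_powerset, Int.card_Icc]
    congr 1
  rw [hcard, countSubsets, countSubsets, ← Finset.card_product, ← Finset.card_product]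
  refine Finset.card_le_card_of_injOn (fun T => (f T, lowFringe b T, highFringe n b T)) ?_ ?_
  · intro T hT
    rw [Finset.mem_coe, Finset.mem_filter, Finset.mem_powerset] at hT
    rw [Finset.mem_coe, Finset.mem_product, Finset.mem_product, Finset.mem_filter,
      Finset.mem_powerset, Finset.mem_powerset, Finset.mem_powerset]
    exact ⟨⟨Finset.filter_subset _ _, f_char T hT.1 hT.2⟩, Finset.filter_subset _ _,
      Finset.filter_subset _ _⟩
  -- Gluing can erase `T` only near its ends; the two recorded fringes of `T` restore that
  -- information.
  · have key : ∀ T T' : Finset ℤ, T ⊆ ground n → f T = f T' → lowFringe b T = lowFringe b T' →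
        highFringe n b T = highFringe n b T' → T ⊆ T' := by
      intro T T' hT h1 h2 h3 x hx
      have hx' := mem_ground.1 (hT hx)
      rcases le_or_gt x b with h | h
      · have := mem_lowFringe.2 ⟨⟨hx'.1, h⟩, hx⟩
        rw [h2] at this
        exact (mem_lowFringe.1 this).2
      · rcases le_or_gt (n - x) b with h' | h'
        · have : (n : ℤ) - x ∈ highFringe n b T :=
            mem_highFringe.2 ⟨⟨by omega, h'⟩, by rwa [sub_sub_cancel]⟩
          rw [h3, mem_highFringe, sub_sub_cancel] at this
          exact this.2
        · have : x + (M + 1) ∈ f T := by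
            rw [mem_f]
            exact ⟨by omega, .inr (.inr (by rwa [add_sub_cancel_right]))⟩
          rw [h1, mem_f, add_sub_cancel_right] at this
          rcases this.2 with h4 | h4 | h4
          · omega
          · omega
          · exact h4
    intro T hT T' hT' h
    rw [Finset.mem_coe, Finset.mem_filter, Finset.mem_powerset] at hT hT'
    simp only [Prod.mk.injEq] at h
    exact (key T T' hT.1 h.1 h.2.1 h.2.2).antisymm
      (key T' T hT'.1 h.1.symm h.2.1.symm h.2.2.symm)

theorem exists_pos_le_rho {Λ : Set (ℕ × ℕ)} (hΛ : ∃ s d : ℕ, (s, d) ∈ Λ ∧ Even d) :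
    ∃ c : ℝ, 0 < c ∧ ∀ᶠ n in atTop, c ≤ rho Λ n := by
  obtain ⟨s, d, hsd, e, rfl⟩ := hΛ
  rw [← two_mul] at hsd
  obtain ⟨M, A, B, hAB, hM⟩ := exists_fringes s e
  have hlim : Tendsto (fun a : ℕ => 8 * (√3 / 2) ^ a / (2 - √3)) atTop (𝓝 0) := by
    have := tendsto_pow_atTop_nhds_zero_of_lt_one sqrt_three_div_two_pos.le
      sqrt_three_div_two_lt_one
    simpa using (this.const_mul 8).div_const (2 - √3)
  obtain ⟨c, hc⟩ := (hlim.eventually_lt_const (show (0 : ℝ) < 1 / 2 by norm_num)).exists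
  -- At least half of the subsets are rich. The first power of two compares the two ground sets, and
  -- the other two count the recorded fringes.
  refine ⟨1 / 2 / (2 ^ (2 * M + 2) * (2 ^ (c + 2 * M + 3) * 2 ^ (c + 2 * M + 3))), by positivity, ?_⟩
  obtain ⟨K, hK⟩ := eventually_atTop.1 eventually_unif_real_not_rich_le
  filter_upwards [eventually_ge_atTop (K + 2 * M + 2 + 2 * (c + 2 * M + 2) + 1)] with n hn
  obtain ⟨m, rfl⟩ : ∃ m, n = m + 2 * M + 2 := ⟨n - 2 * M - 2, by omega⟩
  have h1 := hK m (by omega) c (by omega)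
  have h2 : 1 / 2 ≤ (unif m).real {S | Rich m c S} := by
    have h3 := measureReal_union_le (μ := unif m) {S | Rich m c S} {S | ¬ Rich m c S}
    have h4 : {S | Rich m c S} ∪ {S | ¬ Rich m c S} = Set.univ := by
      ext S
      exact iff_of_true (em _) trivial
    rw [h4, probReal_univ] at h3
    linarith
  have h5 := countSubsets_rich_le (Λ := Λ) (n := m) (c := c) hAB
    (fun A' B' hA hB => by rw [hM _ (by omega) A' B' hA hB]; exact hsd) (by omega)
  rw [rho_eq_unif_real, unif_real, div_le_div_iff₀ (by positivity) (by positivity)]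
  rw [unif_real, le_div_iff₀ (by positivity)] at h2
  have h6 : (countSubsets (ground m) (Rich m c) : ℝ) ≤ _ := Nat.cast_le.2 h5
  push_cast at h6
  have h7 : (2 : ℝ) ^ (m + 2 * M + 2 + 1) = 2 ^ (m + 1) * 2 ^ (2 * M + 2) := by
    rw [← pow_add]; congr 1; omega
  rw [h7]
  have h8 := h2.trans h6
  have p : (0 : ℝ) ≤ 2 ^ (2 * M + 2) := by positivity
  have := mul_le_mul_of_nonneg_right h8 p
  linarith

/-! ### Conditional probabilities and the final estimate -/

/-- A null `s` is harmless: both sides are then zero. -/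
theorem cond_unif_real (n : ℕ) (s t : Set (Finset ℤ)) :
    (cond (unif n) s).real t = ((unif n).real s)⁻¹ * (unif n).real (s ∩ t) := by
  have hs : MeasurableSet s := trivial
  rw [measureReal_def, cond_apply hs, ENNReal.toReal_mul, ENNReal.toReal_inv]
  rfl

theorem three_quarters_rpow_half (a : ℕ) : (3 / 4 : ℝ) ^ ((a : ℝ) / 2) = (√3 / 2) ^ a := by
  rw [← sqrt_three_div_two_sq, ← Real.rpow_natCast_mul sqrt_three_div_two_pos.le,
    ← Real.rpow_natCast]
  congr 1
  push_cast
  ring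

/-- Conditioning on `λₙ(S) ∈ Λ` leaves the middle and the fringes independent, up to twice the
probability that `S` is not rich. -/
theorem abs_cond_inter_sub_le {Λ : Set (ℕ × ℕ)} {n a : ℕ} (ha : 2 * a < n) {E F : Set (Finset ℤ)}
    (hE : DependsOnlyOn n (Finset.Icc ((a : ℤ) + 1) (n - a - 1)) E)
    (hF : DependsOnlyOn n (Finset.Icc 0 (a : ℤ) ∪ Finset.Icc ((n : ℤ) - a) n) F) :
    |(cond (unif n) (charEvent Λ n)).real (E ∩ F) -
        (unif n).real E * (cond (unif n) (charEvent Λ n)).real F| ≤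
      (rho Λ n)⁻¹ * (2 * (unif n).real {S | ¬ Rich n a S}) := by
  have hG := dependsOnlyOn_fringeEvent Λ n a
  set G := fringeEvent Λ n a
  have hFG : DependsOnlyOn n (Finset.Icc 0 (a : ℤ) ∪ Finset.Icc ((n : ℤ) - a) n) (G ∩ F) :=
    fun S T hS hT h => and_congr (hG S T hS hT h) (hF S T hS hT h)
  have h1 : |(unif n).real (charEvent Λ n ∩ (E ∩ F)) - (unif n).real (G ∩ (E ∩ F))| ≤
      (unif n).real {S | ¬ Rich n a S} :=
    abs_unif_real_sub_le_of_rich fun S hS hR =>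
      and_congr_left fun _ => mem_charEvent_iff hS ha hR
  have h2 : |(unif n).real (charEvent Λ n ∩ F) - (unif n).real (G ∩ F)| ≤
      (unif n).real {S | ¬ Rich n a S} :=
    abs_unif_real_sub_le_of_rich fun S hS hR =>
      and_congr_left fun _ => mem_charEvent_iff hS ha hR
  have h3 : (unif n).real (G ∩ (E ∩ F)) = (unif n).real E * (unif n).real (G ∩ F) := by
    rw [Set.inter_left_comm]
    exact unif_real_inter (disjoint_middle_fringe n a) (middle_union_fringe ha) hE hFG
  have hE0 : 0 ≤ (unif n).real E := measureReal_nonneg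
  have hE1 : (unif n).real E ≤ 1 := measureReal_le_one
  rw [cond_unif_real, cond_unif_real, ← rho_eq_unif_real, mul_left_comm, ← mul_sub, abs_mul,
    abs_of_nonneg (inv_nonneg.2 (rho_eq_unif_real Λ n ▸ measureReal_nonneg))]
  refine mul_le_mul_of_nonneg_left ?_ (inv_nonneg.2 (rho_eq_unif_real Λ n ▸ measureReal_nonneg))
  rw [h3] at h1
  -- Both brackets compare `charEvent` with the fringe event `G`, so each is at most the non-rich
  -- probability; the second carries the factor `P(E) ≤ 1`.
  have h4 : (unif n).real (charEvent Λ n ∩ (E ∩ F)) -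
      (unif n).real E * (unif n).real (charEvent Λ n ∩ F) =
      ((unif n).real (charEvent Λ n ∩ (E ∩ F)) - (unif n).real E * (unif n).real (G ∩ F)) -
        (unif n).real E * ((unif n).real (charEvent Λ n ∩ F) - (unif n).real (G ∩ F)) := by ring
  rw [h4]
  refine (abs_sub _ _).trans ?_
  rw [abs_mul, abs_of_nonneg hE0]
  have h5 := mul_le_of_le_one_left (abs_nonneg
    ((unif n).real (charEvent Λ n ∩ F) - (unif n).real (G ∩ F))) hE1
  linarith

end MiddleFringe

theorem theorem3 (Λ : Set (ℕ × ℕ)) (hΛ : ∃ s d : ℕ, (s, d) ∈ Λ ∧ Even d) :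
    ∃ ρ : ℝ, 0 < ρ ∧ Tendsto (MiddleFringe.rho Λ) atTop (𝓝 ρ) ∧
      ∀ α : ℕ → ℤ, (∀ᶠ n : ℕ in atTop, 0 < α n ∧ 2 * α n < (n : ℤ)) →
        Tendsto α atTop atTop →
        ∀ ε : ℝ, 0 < ε → ∀ᶠ n : ℕ in atTop, ∀ E F : Set (Finset ℤ),
          MiddleFringe.DependsOnlyOn n (Finset.Icc (α n + 1) (n - α n - 1)) E →
          MiddleFringe.DependsOnlyOn n (Finset.Icc 0 (α n) ∪ Finset.Icc (n - α n) n) F →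
          |(cond (MiddleFringe.unif n) (MiddleFringe.charEvent Λ n)).real (E ∩ F) -
              (MiddleFringe.unif n).real E *
                (cond (MiddleFringe.unif n) (MiddleFringe.charEvent Λ n)).real F|
            ≤ (1 + ε) * (24 * (3 / 4 : ℝ) ^ ((α n : ℝ) / 2) / ((2 - √3) * ρ)) := by
  obtain ⟨ρ, hρ⟩ := MiddleFringe.exists_tendsto_rho Λ
  obtain ⟨c, hc, hcρ⟩ := MiddleFringe.exists_pos_le_rho hΛ
  have hρ0 : 0 < ρ := hc.trans_le (ge_of_tendsto hρ hcρ)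
  refine ⟨ρ, hρ0, hρ, fun α hα _ ε hε => ?_⟩
  -- The factor `1 + ε` pays only for replacing `rho Λ n` by its limit.
  have hlt : ρ / (1 + ε) < ρ := div_lt_self hρ0 (by linarith)
  filter_upwards [hα, MiddleFringe.eventually_unif_real_not_rich_le,
    hρ.eventually_const_lt hlt] with n hn hrich hrho E F hE hF
  obtain ⟨a, ha⟩ : ∃ a : ℕ, α n = a := ⟨(α n).toNat, by omega⟩
  rw [ha] at hn hE hF ⊢
  have han : 2 * a < n := by omega
  rw [Int.cast_natCast, MiddleFringe.three_quarters_rpow_half]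
  refine (MiddleFringe.abs_cond_inter_sub_le han hE hF).trans ?_
  have h2 : 0 < 2 - √3 := by linarith [MiddleFringe.sqrt_three_div_two_lt_one]
  have hinv : (MiddleFringe.rho Λ n)⁻¹ ≤ (1 + ε) / ρ := by
    rw [← inv_div]
    exact inv_anti₀ (by positivity) hrho.le
  -- Twice the non-rich bound gives the constant `16`, which is below `24`.
  have hb : 2 * (MiddleFringe.unif n).real {S | ¬ MiddleFringe.Rich n a S} ≤
      24 * (√3 / 2) ^ a / (2 - √3) := by
    have h3 : 24 * (√3 / 2) ^ a / (2 - √3) = 3 * (8 * (√3 / 2) ^ a / (2 - √3)) := by ring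
    have h4 : 0 ≤ 8 * (√3 / 2) ^ a / (2 - √3) := by positivity
    linarith [hrich a han]
  calc _ ≤ (1 + ε) / ρ * (24 * (√3 / 2) ^ a / (2 - √3)) :=
        mul_le_mul hinv hb (by positivity) (by positivity)
    _ = _ := by
        field_simp
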